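/- Let $N \in \mathbb{N}$, let $1 < p \le N$ and $p \le q < p^*$, where $p^* = \frac{Np}{N-p}$ if $p < N$ and $p^* = +\infty$ if $p = N$ (so for $p = N$ every $q \ge p$ is allowed). Let $a^* > 0$, let $m_0 \ge 1$ be an integer, and let $a_0^* > 0$. Then there is a constant $C > 0$, depending only on $N, p, q, a^*, m_0, a_0^*$, such that the following holds for every bounded open set $\Omega \subset \mathbb{R}^N$ and every $u \in W_0^{1,p}(\Omega)$. Here $|D|$ is the Lebesgue measure of $D$ and $\|u\|_\Omega = \left(\int_\Omega |\nabla u|^p\,dx + \int_\Omega |u|^p\,dx\right)^{1/p}$. (i) For real $m$ put $\Omega_m^+ = \{x \in \Omega : u(x) > m\}$. If $$\int_{\Omega_m^+} |\nabla u|^p\,dx \le a^*\left(m^q\,|\Omega_m^+| + \int_{\Omega_m^+} |u|^q\,dx\right)\quad\text{for all real } m \ge m_0$$ and $\max\{|\Omega_{m_0}^+|, \|u\|_\Omega\} \le a_0^*$, then $\operatorname{ess\,sup}_\Omega u \le C$. (ii) For real $m$ put $\Omega_m^- = \{x \in \Omega : u(x) < -m\}$. If $$\int_{\Omega_m^-}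 |\nabla u|^p\,dx \le a^*\left(m^q\,|\Omega_m^-| + \int_{\Omega_m^-} |u|^q\,dx\right)\quad\text{for all real } m \ge m_0$$ and $\max\{|\Omega_{m_0}^-|, \|u\|_\Omega\} \le a_0^*$, then $\operatorname{ess\,sup}_\Omega (-u) \le C$. -/

import Mathlib

open MeasureTheory
open scoped ENNReal ContDiff

noncomputable section

/-- The critical Sobolev exponent `p^*`: it is `N p / (N - p)` if `p < N`, and `+∞` if `p ≥ N`. -/
def sobolevExponent (N : ℕ) (p : ℝ) : EReal :=
  if p < N then ((N * p / (N - p) : ℝ) : EReal) else ⊤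

/-- `φ ∈ C_c^∞(Ω)`. -/
structure IsTestFunction {N : ℕ} (Ω : Set (EuclideanSpace ℝ (Fin N)))
    (φ : EuclideanSpace ℝ (Fin N) → ℝ) : Prop where
  smooth : ContDiff ℝ ∞ φ
  compact_support : HasCompactSupport φ
  support_subset : tsupport φ ⊆ Ω

/-- `g` is the weak (distributional) gradient of `u` in `Ω`: both are locally integrable in `Ω` and
`∫_Ω u ∇φ dx = - ∫_Ω φ g dx` (an identity between vectors) for all `φ ∈ C_c^∞(Ω)`. -/
structure IsWeakGradient {N : ℕ} (Ω : Set (EuclideanSpace ℝ (Fin N)))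
    (u : EuclideanSpace ℝ (Fin N) → ℝ)
    (g : EuclideanSpace ℝ (Fin N) → EuclideanSpace ℝ (Fin N)) : Prop where
  locallyIntegrable : LocallyIntegrableOn u Ω volume
  locallyIntegrable_grad : LocallyIntegrableOn g Ω volume
  integral_eq : ∀ φ : EuclideanSpace ℝ (Fin N) → ℝ, IsTestFunction Ω φ →
    ∫ x in Ω, u x • gradient φ x = - ∫ x in Ω, φ x • g x

/-- The Sobolev norm `‖u‖_Ω = (∫_Ω |∇u|^p dx + ∫_Ω |u|^p dx)^{1/p}`, with `g` in the role of
`∇u` and with values in `[0, ∞]`. -/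
def sobolevNorm {N : ℕ} (Ω : Set (EuclideanSpace ℝ (Fin N))) (p : ℝ)
    (u : EuclideanSpace ℝ (Fin N) → ℝ)
    (g : EuclideanSpace ℝ (Fin N) → EuclideanSpace ℝ (Fin N)) : ℝ≥0∞ :=
  ((∫⁻ x in Ω, ‖g x‖ₑ ^ p) + ∫⁻ x in Ω, ‖u x‖ₑ ^ p) ^ (1 / p)

/-- `u ∈ W^{1,p}(Ω)`, with weak gradient `g`. -/
structure MemW1p {N : ℕ} (Ω : Set (EuclideanSpace ℝ (Fin N))) (p : ℝ)
    (u : EuclideanSpace ℝ (Fin N) → ℝ)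
    (g : EuclideanSpace ℝ (Fin N) → EuclideanSpace ℝ (Fin N)) : Prop where
  memLp : MemLp u (ENNReal.ofReal p) (volume.restrict Ω)
  memLp_grad : MemLp g (ENNReal.ofReal p) (volume.restrict Ω)
  isWeakGradient : IsWeakGradient Ω u g

/-- `u ∈ W_0^{1,p}(Ω)`, with weak gradient `g`: the function `u` belongs to the closure of
`C_c^∞(Ω)` in `W^{1,p}(Ω)`. -/
structure MemW01p {N : ℕ} (Ω : Set (EuclideanSpace ℝ (Fin N))) (p : ℝ)
    (u : EuclideanSpace ℝ (Fin N) → ℝ)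
    (g : EuclideanSpace ℝ (Fin N) → EuclideanSpace ℝ (Fin N)) : Prop where
  memW1p : MemW1p Ω p u g
  exists_approx : ∀ ε : ℝ≥0∞, 0 < ε → ∃ φ : EuclideanSpace ℝ (Fin N) → ℝ,
    IsTestFunction Ω φ ∧
      sobolevNorm Ω p (fun x => u x - φ x) (fun x => g x - gradient φ x) < ε

/-- `Ω_m^+ = {x ∈ Ω : u(x) > m}`. -/
def superlevel {N : ℕ} (Ω : Set (EuclideanSpace ℝ (Fin N)))
    (u : EuclideanSpace ℝ (Fin N) → ℝ) (m : ℝ) : Set (EuclideanSpace ℝ (Fin N)) :=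
  {x | x ∈ Ω ∧ m < u x}

/-- `Ω_m^- = {x ∈ Ω : u(x) < -m}`. -/
def sublevel {N : ℕ} (Ω : Set (EuclideanSpace ℝ (Fin N)))
    (u : EuclideanSpace ℝ (Fin N) → ℝ) (m : ℝ) : Set (EuclideanSpace ℝ (Fin N)) :=
  {x | x ∈ Ω ∧ u x < -m}

end

/-! The proof is a De Giorgi iteration on the levels of `u`. Put y(m) = |Ω_m^+|^(1/r) and W(m) = ‖(u
- m)⁺‖_{L^r}, with r > q a Sobolev exponent. The Sobolev inequality for the truncation
(`MemW01p.eLpNorm_truncation_le`), the energy hypothesis and Hölder give W^p ≤ B (m^q y^r + W^q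
y^(r-q)), and Chebyshev gives (h - m) y(h) ≤ W(m). All constants come from the data, since a₀ bounds
both the measures and the gradient norm.

For m ≥ M with M large, y(m) is O(1/M), so the second term is absorbed into the left side. On levels
rising from M to 2M this leaves y_{j+1}^p ≤ c 2^(pj) y_j^r with r > p, which forces y_j → 0 once y_0
is small (`exists_level_eq_zero`). The smallness condition scales like M^(-(r-q)), which is where q
< p^* enters. Hence C = 2M.

Truncations are treated through smooth truncations of test functions and a limit. Part (ii) is part
(i) for -u. -/

/-! ### Smooth truncation -/

/-- A `C¹` approximation from below of the positive part `t ↦ max t 0`. -/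
noncomputable def smoothPosPart (ε t : ℝ) : ℝ := Real.sqrt (max t 0 ^ 2 + ε ^ 2) - ε

/-- The derivative of `smoothPosPart ε`. -/
noncomputable def smoothPosPartDeriv (ε t : ℝ) : ℝ := max t 0 / Real.sqrt (max t 0 ^ 2 + ε ^ 2)

/-- Squaring removes the kink of the positive part: at 0 the function is O(t²), hence o(t). -/
theorem hasDerivAt_max_zero_sq (t : ℝ) :
    HasDerivAt (fun t : ℝ => max t 0 ^ 2) (2 * max t 0) t := by
  rcases lt_trichotomy t 0 with h | h | h
  · rw [max_eq_right h.le, mul_zero]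
    refine (hasDerivAt_const t (0 : ℝ)).congr_of_eventuallyEq ?_
    filter_upwards [eventually_lt_nhds h] with x hx
    rw [max_eq_right hx.le]; norm_num
  · subst h
    simp only [max_self, mul_zero]
    rw [hasDerivAt_iff_isLittleO_nhds_zero]
    have h2 : (fun h : ℝ => h ^ 2) =o[nhds 0] fun h : ℝ => h := by
      simpa using Asymptotics.isLittleO_pow_pow (𝕜 := ℝ) (m := 1) (n := 2) (by norm_num)
    refine Asymptotics.IsBigO.trans_isLittleO (Asymptotics.IsBigO.of_bound 1 ?_) h2
    filter_upwards with x
    simp only [zero_add, max_self, smul_zero, sub_zero, norm_pow, one_mul]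
    rw [Real.norm_eq_abs, Real.norm_eq_abs]
    norm_num
    rcases le_total x 0 with hx | hx
    · simpa [max_eq_right hx] using sq_nonneg x
    · rw [max_eq_left hx]
  · rw [max_eq_left h.le]
    have : HasDerivAt (fun t : ℝ => t ^ 2) (2 * t) t := by simpa using hasDerivAt_pow 2 t
    refine this.congr_of_eventuallyEq ?_
    filter_upwards [eventually_gt_nhds h] with x hx
    rw [max_eq_left hx.le]

section SmoothPosPart

variable {ε : ℝ}

theorem hasDerivAt_smoothPosPart (hε : 0 < ε) (t : ℝ) :
    HasDerivAt (smoothPosPart ε) (smoothPosPartDeriv ε t) t := by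
  have h : max t 0 ^ 2 + ε ^ 2 ≠ 0 := by positivity
  convert! (((hasDerivAt_max_zero_sq t).add_const (ε ^ 2)).sqrt h).sub_const ε using 1
  rw [smoothPosPartDeriv, mul_div_mul_left _ _ two_ne_zero]

theorem continuous_smoothPosPartDeriv (hε : 0 < ε) : Continuous (smoothPosPartDeriv ε) := by
  unfold smoothPosPartDeriv
  refine Continuous.div (by fun_prop) (by fun_prop) fun t => ?_
  positivity

theorem contDiff_smoothPosPart (hε : 0 < ε) : ContDiff ℝ 1 (smoothPosPart ε) := by
  rw [contDiff_one_iff_deriv]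
  refine ⟨fun t => (hasDerivAt_smoothPosPart hε t).differentiableAt, ?_⟩
  rw [show deriv (smoothPosPart ε) = smoothPosPartDeriv ε from
    funext fun t => (hasDerivAt_smoothPosPart hε t).deriv]
  exact continuous_smoothPosPartDeriv hε

theorem smoothPosPart_of_nonpos (hε : 0 < ε) {t : ℝ} (ht : t ≤ 0) : smoothPosPart ε t = 0 := by
  simp [smoothPosPart, max_eq_right ht, Real.sqrt_sq hε.le]

theorem smoothPosPartDeriv_of_nonpos {t : ℝ} (ht : t ≤ 0) : smoothPosPartDeriv ε t = 0 := by
  simp [smoothPosPartDeriv, max_eq_right ht]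

theorem abs_smoothPosPartDeriv_le_one (t : ℝ) : |smoothPosPartDeriv ε t| ≤ 1 := by
  rw [smoothPosPartDeriv, abs_of_nonneg (by positivity)]
  refine div_le_one_of_le₀ (Real.le_sqrt_of_sq_le ?_) (Real.sqrt_nonneg _)
  nlinarith [sq_nonneg ε]

theorem tendsto_smoothPosPart (t : ℝ) :
    Filter.Tendsto (fun ε => smoothPosPart ε t) (nhds 0) (nhds (max t 0)) := by
  have : Continuous fun ε => smoothPosPart ε t := by unfold smoothPosPart; fun_prop
  simpa [smoothPosPart, Real.sqrt_sq] using this.tendsto 0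

end SmoothPosPart

/-! ### Sobolev inequality for truncations -/

theorem norm_gradient {E : Type*} [NormedAddCommGroup E] [InnerProductSpace ℝ E]
    [CompleteSpace E] (f : E → ℝ) (x : E) : ‖gradient f x‖ = ‖fderiv ℝ f x‖ := by
  simp [gradient]

theorem norm_fderiv_comp_sub_const {E : Type*} [NormedAddCommGroup E] [InnerProductSpace ℝ E]
    [CompleteSpace E] {F : ℝ → ℝ} {F' m : ℝ} {f : E → ℝ} {x : E}
    (hF : HasDerivAt F F' (f x - m)) (hf : DifferentiableAt ℝ f x) :
    ‖fderiv ℝ (fun y => F (f y - m)) x‖ = ‖F' • gradient f x‖ := by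
  have h : HasFDerivAt (fun y => F (f y - m)) (F' • fderiv ℝ f x) x :=
    hF.comp_hasFDerivAt x (hf.hasFDerivAt.sub_const m)
  rw [h.fderiv, norm_smul, norm_smul, norm_gradient]

/-- The Gagliardo–Nirenberg–Sobolev inequality for truncated test functions. -/
theorem IsTestFunction.eLpNorm_smoothPosPart_le {N : ℕ} {Ω : Set (EuclideanSpace ℝ (Fin N))}
    {φ : EuclideanSpace ℝ (Fin N) → ℝ} (hφ : IsTestFunction Ω φ) (hN : 0 < N) {s r : NNReal}
    (hs : 1 ≤ s) (hsr : (r : ℝ)⁻¹ = s⁻¹ - (N : ℝ)⁻¹) {ε : ℝ} (hε : 0 < ε) {m : ℝ} (hm : 0 ≤ m) :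
    eLpNorm (fun x => smoothPosPart ε (φ x - m)) r (volume.restrict Ω) ≤
      SNormLESNormFDerivOfEqConst ℝ (volume : Measure (EuclideanSpace ℝ (Fin N))) s *
        eLpNorm (fun x => smoothPosPartDeriv ε (φ x - m) • gradient φ x) s
          (volume.restrict Ω) := by
  -- The gradient lives in Ω, so its norm over the whole space, where Sobolev applies, equals its
  -- norm over Ω.
  have hsub : tsupport (gradient φ) ⊆ tsupport φ := by
    refine closure_minimal (fun x hx => ?_) isClosed_closure
    by_contra h
    refine hx (norm_eq_zero.1 ?_)
    rw [norm_gradient, norm_eq_zero]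
    exact image_eq_zero_of_notMem_tsupport fun h' => h (tsupport_fderiv_subset ℝ h')
  rw [eLpNorm_restrict_eq_of_support_subset (f := fun x =>
    smoothPosPartDeriv ε (φ x - m) • gradient φ x)]
  · refine (eLpNorm_mono_measure _ Measure.restrict_le_self).trans ?_
    have hc1 : ContDiff ℝ 1 fun x => smoothPosPart ε (φ x - m) :=
      (contDiff_smoothPosPart hε).comp ((hφ.smooth.of_le (by simp)).sub contDiff_const)
    -- Since m ≥ 0, the truncation vanishes wherever φ does.
    have hc2 : HasCompactSupport fun x => smoothPosPart ε (φ x - m) :=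
      hφ.compact_support.comp_left (g := fun t => smoothPosPart ε (t - m))
        (smoothPosPart_of_nonpos hε (by linarith))
    refine (eLpNorm_le_eLpNorm_fderiv_of_eq volume hc1 hc2 hs (by simpa using hN)
      (by simpa using hsr)).trans (le_of_eq ?_)
    congr 1
    refine eLpNorm_congr_norm_ae (Filter.Eventually.of_forall fun x => ?_)
    exact norm_fderiv_comp_sub_const (hasDerivAt_smoothPosPart hε _)
      (hφ.smooth.differentiable (by simp) x)
  · intro x hx
    refine hφ.support_subset (hsub (subset_closure fun h => hx ?_))
    simp [h]

/-- Dominated convergence for `L^s` seminorms of products with bounded scalar factors. -/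
theorem tendsto_eLpNorm_smul {α E : Type*} [MeasurableSpace α] {μ : Measure α}
    [NormedAddCommGroup E] [NormedSpace ℝ E] {s : ℝ≥0∞} (hs : s ≠ 0) (hs' : s ≠ ⊤)
    {g : α → E} (hg : MemLp g s μ) {c : ℕ → α → ℝ} {c₀ : α → ℝ}
    (hc : ∀ n, AEStronglyMeasurable (c n) μ) (hc1 : ∀ n x, |c n x| ≤ 1)
    (hlim : ∀ᵐ x ∂μ, Filter.Tendsto (fun n => c n x) Filter.atTop (nhds (c₀ x))) :
    Filter.Tendsto (fun n => eLpNorm (fun x => c n x • g x) s μ) Filter.atTop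
      (nhds (eLpNorm (fun x => c₀ x • g x) s μ)) := by
  simp only [eLpNorm_eq_lintegral_rpow_enorm_toReal hs hs']
  refine (ENNReal.continuous_rpow_const.tendsto _).comp ?_
  refine tendsto_lintegral_of_dominated_convergence' (fun x => ‖g x‖ₑ ^ s.toReal)
    (fun n => ((hc n).smul hg.1).enorm.pow_const _) (fun n => ?_) ?_ ?_
  · filter_upwards with x
    gcongr
    rw [enorm_smul]
    refine mul_le_of_le_one_left (zero_le) ?_
    rw [Real.enorm_eq_ofReal_abs]
    exact ENNReal.ofReal_le_one.2 (hc1 n x)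
  · exact (lintegral_rpow_enorm_lt_top_of_eLpNorm_lt_top hs hs' hg.2).ne
  · filter_upwards [hlim] with x hx
    exact (ENNReal.continuous_rpow_const.tendsto _).comp
      ((continuous_enorm.tendsto _).comp (hx.smul_const _))

theorem eLpNorm_le_sobolevNorm {N : ℕ} (Ω : Set (EuclideanSpace ℝ (Fin N))) {p : ℝ} (hp : 0 < p)
    (u : EuclideanSpace ℝ (Fin N) → ℝ) (g : EuclideanSpace ℝ (Fin N) → EuclideanSpace ℝ (Fin N)) :
    eLpNorm u (ENNReal.ofReal p) (volume.restrict Ω) ≤ sobolevNorm Ω p u g ∧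
      eLpNorm g (ENNReal.ofReal p) (volume.restrict Ω) ≤ sobolevNorm Ω p u g := by
  have h0 : ENNReal.ofReal p ≠ 0 := by simpa using hp
  constructor <;> rw [eLpNorm_eq_lintegral_rpow_enorm_toReal h0 ENNReal.ofReal_ne_top,
    ENNReal.toReal_ofReal hp.le, sobolevNorm]
  · exact ENNReal.rpow_le_rpow le_add_self (by positivity)
  · exact ENNReal.rpow_le_rpow le_self_add (by positivity)

/-- L^p convergence implies convergence in measure, hence almost everywhere along a subsequence. -/
theorem MemW01p.exists_seq {N : ℕ} {Ω : Set (EuclideanSpace ℝ (Fin N))} {p : ℝ} (hp : 0 < p)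
    {u : EuclideanSpace ℝ (Fin N) → ℝ}
    {g : EuclideanSpace ℝ (Fin N) → EuclideanSpace ℝ (Fin N)} (h : MemW01p Ω p u g) :
    ∃ φ : ℕ → EuclideanSpace ℝ (Fin N) → ℝ, (∀ n, IsTestFunction Ω (φ n)) ∧
      (∀ᵐ x ∂(volume.restrict Ω), Filter.Tendsto (fun n => φ n x) Filter.atTop (nhds (u x))) ∧
      Filter.Tendsto (fun n => eLpNorm (fun x => g x - gradient (φ n) x) (ENNReal.ofReal p)
        (volume.restrict Ω)) Filter.atTop (nhds 0) := by
  choose φ hφ hφn using fun n : ℕ => h.exists_approx ((n : ℝ≥0∞) + 1)⁻¹ (by simp)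
  have hinv : Filter.Tendsto (fun n : ℕ => ((n : ℝ≥0∞) + 1)⁻¹) Filter.atTop (nhds 0) := by
    have := (Filter.tendsto_add_atTop_iff_nat 1).2 ENNReal.tendsto_inv_nat_nhds_zero
    simpa using this
  have hu : Filter.Tendsto (fun n => eLpNorm (φ n - u) (ENNReal.ofReal p) (volume.restrict Ω))
      Filter.atTop (nhds 0) := by
    refine tendsto_of_tendsto_of_tendsto_of_le_of_le tendsto_const_nhds hinv
      (fun _ => zero_le) fun n => ?_
    rw [eLpNorm_sub_comm]
    exact (eLpNorm_le_sobolevNorm Ω hp _ _).1.trans (hφn n).le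
  obtain ⟨ns, hns, hae⟩ := (tendstoInMeasure_of_tendsto_eLpNorm (by simpa using hp)
    (fun n => (hφ n).smooth.continuous.aestronglyMeasurable) h.memW1p.memLp.1
    hu).exists_seq_tendsto_ae
  refine ⟨fun n => φ (ns n), fun n => hφ _, hae, ?_⟩
  exact tendsto_of_tendsto_of_tendsto_of_le_of_le tendsto_const_nhds
    (hinv.comp hns.tendsto_atTop) (fun _ => zero_le)
    fun n => (eLpNorm_le_sobolevNorm Ω hp _ _).2.trans (hφn _).le

theorem IsTestFunction.continuous_gradient {N : ℕ} {Ω : Set (EuclideanSpace ℝ (Fin N))}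
    {φ : EuclideanSpace ℝ (Fin N) → ℝ} (hφ : IsTestFunction Ω φ) : Continuous (gradient φ) :=
  (InnerProductSpace.toDual ℝ _).symm.continuous.comp (hφ.smooth.continuous_fderiv (by simp))

/-- The Sobolev inequality for the truncation `(u - m)⁺` of a function in `W_0^{1,p}(Ω)`. -/
theorem MemW01p.eLpNorm_truncation_le {N : ℕ} {Ω : Set (EuclideanSpace ℝ (Fin N))} {p : ℝ}
    {u : EuclideanSpace ℝ (Fin N) → ℝ}
    {g : EuclideanSpace ℝ (Fin N) → EuclideanSpace ℝ (Fin N)} (h : MemW01p Ω p u g)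
    (hΩ : MeasurableSet Ω) (hΩ' : volume Ω ≠ ⊤) (hN : 0 < N) {s r : NNReal}
    (hs : 1 ≤ s) (hsp : s ≤ p) (hsr : (r : ℝ)⁻¹ = s⁻¹ - (N : ℝ)⁻¹) {m : ℝ} (hm : 0 ≤ m) :
    eLpNorm (fun x => max (u x - m) 0) r (volume.restrict Ω) ≤
      SNormLESNormFDerivOfEqConst ℝ (volume : Measure (EuclideanSpace ℝ (Fin N))) s *
        eLpNorm g s (volume.restrict (superlevel Ω u m)) := by
  have hfin : IsFiniteMeasure (volume.restrict Ω) := ⟨by simpa using hΩ'.lt_top⟩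
  have hp : 0 < p := lt_of_lt_of_le (by exact_mod_cast zero_lt_one.trans_le hs) hsp
  have hsp' : (s : ℝ≥0∞) ≤ ENNReal.ofReal p := by
    rw [← ENNReal.ofReal_coe_nnreal]; exact ENNReal.ofReal_le_ofReal hsp
  have hs0 : (s : ℝ≥0∞) ≠ 0 := by
    have := zero_lt_one.trans_le hs; exact_mod_cast this.ne'
  have hu := h.memW1p.memLp.1
  have hgm := h.memW1p.memLp_grad.1
  have hg : MemLp g s (volume.restrict Ω) := h.memW1p.memLp_grad.mono_exponent hsp'
  obtain ⟨φ, hφ, hae, hgrad⟩ := h.exists_seq hp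
  -- Finite measure and s ≤ p turn L^p convergence of the gradients into L^s convergence.
  have hgrad' : Filter.Tendsto (fun n => eLpNorm (fun x => g x - gradient (φ n) x) s
      (volume.restrict Ω)) Filter.atTop (nhds 0) := by
    have ht := ENNReal.Tendsto.mul_const (b := (volume.restrict Ω) Set.univ ^
      (1 / (s : ℝ≥0∞).toReal - 1 / (ENNReal.ofReal p).toReal)) hgrad (Or.inr ?_)
    · rw [zero_mul] at ht
      refine tendsto_of_tendsto_of_tendsto_of_le_of_le tendsto_const_nhds ht
        (fun _ => zero_le) fun n => ?_
      exact eLpNorm_le_eLpNorm_mul_rpow_measure_univ hsp'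
        (hgm.sub (hφ n).continuous_gradient.aestronglyMeasurable)
    · refine ENNReal.rpow_ne_top_of_nonneg ?_ (measure_ne_top _ _)
      rw [ENNReal.coe_toReal, ENNReal.toReal_ofReal hp.le, sub_nonneg]
      exact one_div_le_one_div_of_le (by exact_mod_cast zero_lt_one.trans_le hs) hsp
  -- The limit n → ∞ is taken at fixed ε, where the derivative of the truncation is continuous; ε →
  -- 0 comes afterwards. Fatou handles the left side both times.
  have key : ∀ ε : ℝ, 0 < ε → eLpNorm (fun x => smoothPosPart ε (u x - m)) r
      (volume.restrict Ω) ≤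
      SNormLESNormFDerivOfEqConst ℝ (volume : Measure (EuclideanSpace ℝ (Fin N))) s *
        eLpNorm g s (volume.restrict (superlevel Ω u m)) := by
    intro ε hε
    have hcont := continuous_smoothPosPartDeriv hε
    have hcm : ∀ n, Continuous fun x => smoothPosPartDeriv ε (φ n x - m) := fun n =>
      hcont.comp ((hφ n).smooth.continuous.sub continuous_const)
    have hlim := tendsto_eLpNorm_smul hs0 ENNReal.coe_ne_top hg
      (c := fun n x => smoothPosPartDeriv ε (φ n x - m))
      (c₀ := fun x => smoothPosPartDeriv ε (u x - m))
      (fun n => (hcm n).aestronglyMeasurable) (fun n x => abs_smoothPosPartDeriv_le_one _)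
      (by
        filter_upwards [hae] with x hx
        exact (hcont.tendsto _).comp (hx.sub_const m))
    have hsuper : eLpNorm (fun x => smoothPosPartDeriv ε (u x - m) • g x) s (volume.restrict Ω) ≤
        eLpNorm g s (volume.restrict (superlevel Ω u m)) := by
      have hsupp : (fun x => smoothPosPartDeriv ε (u x - m) • g x).support ⊆ {x | m < u x} := by
        intro x hx
        by_contra hxm
        refine hx ?_
        simp only [smoothPosPartDeriv_of_nonpos (sub_nonpos.2 (not_lt.1 hxm)), zero_smul]
      rw [← eLpNorm_restrict_eq_of_support_subset hsupp, Measure.restrict_restrict' hΩ]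
      have : {x | m < u x} ∩ Ω = superlevel Ω u m := by
        ext x; simp [superlevel, and_comm]
      rw [this]
      refine eLpNorm_mono fun x => ?_
      rw [norm_smul]
      exact mul_le_of_le_one_left (norm_nonneg _) (abs_smoothPosPartDeriv_le_one _)
    have hR := ENNReal.Tendsto.const_mul
      (a := (SNormLESNormFDerivOfEqConst ℝ (volume : Measure (EuclideanSpace ℝ (Fin N))) s :
        ℝ≥0∞)) (hlim.add hgrad') (Or.inr ENNReal.coe_ne_top)
    refine (Lp.eLpNorm_lim_le_liminf_eLpNorm
      (f := fun n x => smoothPosPart ε (φ n x - m)) (fun n => ?_) _ ?_).trans ?_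
    · exact ((contDiff_smoothPosPart hε).continuous.comp
        ((hφ n).smooth.continuous.sub continuous_const)).aestronglyMeasurable
    · filter_upwards [hae] with x hx
      exact ((contDiff_smoothPosPart hε).continuous.tendsto _).comp (hx.sub_const m)
    refine (Filter.liminf_le_liminf (Filter.Eventually.of_forall fun n => ?_)).trans
      (hR.liminf_eq.le.trans ?_)
    · refine ((hφ n).eLpNorm_smoothPosPart_le hN hs hsr hε hm).trans ?_
      gcongr
      -- The first term converges by dominated convergence; the second tends to 0 in L^s because its
      -- scalar factor is at most 1.
      have e : (fun x => smoothPosPartDeriv ε (φ n x - m) • gradient (φ n) x) =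
          (fun x => smoothPosPartDeriv ε (φ n x - m) • g x) -
            fun x => smoothPosPartDeriv ε (φ n x - m) • (g x - gradient (φ n) x) := by
        ext1 x; simp [smul_sub]
      rw [e]
      refine (eLpNorm_sub_le ((hcm n).aestronglyMeasurable.smul hgm)
        ((hcm n).aestronglyMeasurable.smul
          (hgm.sub (hφ n).continuous_gradient.aestronglyMeasurable))
        (by exact_mod_cast hs)).trans (add_le_add le_rfl (eLpNorm_mono fun x => ?_))
      rw [Pi.smul_apply', norm_smul]
      exact mul_le_of_le_one_left (norm_nonneg _) (abs_smoothPosPartDeriv_le_one _)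
    · rw [add_zero]
      gcongr
  refine (Lp.eLpNorm_lim_le_liminf_eLpNorm
    (f := fun (n : ℕ) x => smoothPosPart (1 / ((n : ℝ) + 1)) (u x - m)) (fun n => ?_) _ ?_).trans
      (Filter.liminf_le_of_frequently_le' (Filter.Frequently.of_forall fun n =>
        key _ (by positivity)))
  · exact (contDiff_smoothPosPart (by positivity)).continuous.comp_aestronglyMeasurable
      (hu.sub aestronglyMeasurable_const)
  · filter_upwards with x
    exact (tendsto_smoothPosPart _).comp tendsto_one_div_add_atTop_nhds_zero_nat

/-! ### De Giorgi iteration -/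

/-- The geometric decay step of a De Giorgi iteration. -/
theorem le_geometric_of_rpow_le {p r c b Y : ℝ} (hp : 0 < p) (hpr : p < r) (hc : 0 ≤ c)
    (hb : 1 < b) (hY : 0 < Y) (hcY : c * Y ^ (r - p) ≤ (b ^ (-(p / (r - p)))) ^ p)
    {y : ℕ → ℝ} (hy : ∀ j, 0 ≤ y j) (h0 : y 0 ≤ Y)
    (hstep : ∀ j, y (j + 1) ^ p ≤ c * (b ^ p) ^ j * y j ^ r) (j : ℕ) :
    y j ≤ Y * (b ^ (-(p / (r - p)))) ^ j := by
  have hb0 : 0 < b := by linarith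
  set l := b ^ (-(p / (r - p))) with hl
  have hl0 : 0 < l := by positivity
  -- The ratio l is chosen so that the superlinear gain l^(r-p) exactly cancels the growth b^p of
  -- each step.
  have hlr : b ^ p * l ^ (r - p) = 1 := by
    rw [hl, ← Real.rpow_mul hb0.le, ← Real.rpow_add hb0]
    have : r - p ≠ 0 := by linarith
    rw [show p + -(p / (r - p)) * (r - p) = 0 by field_simp; ring, Real.rpow_zero]
  induction j with
  | zero => simpa using h0
  | succ j ih =>
    refine (Real.rpow_le_rpow_iff (hy _) (by positivity) hp).1 ((hstep j).trans ?_)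
    calc c * (b ^ p) ^ j * y j ^ r ≤ c * (b ^ p) ^ j * (Y * l ^ j) ^ r := by
          gcongr
          · exact hy j
          · linarith
      _ = (c * Y ^ (r - p)) * ((b ^ p * l ^ (r - p)) ^ j) * (Y * l ^ j) ^ p := by
          have : (Y * l ^ j) ^ r = (Y * l ^ j) ^ (r - p) * (Y * l ^ j) ^ p := by
            rw [← Real.rpow_add (by positivity)]; congr 1; ring
          rw [this, Real.mul_rpow (z := r - p) hY.le (by positivity), mul_pow,
            Real.rpow_pow_comm hl0.le]
          ring
      _ ≤ l ^ p * 1 * (Y * l ^ j) ^ p := by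
          rw [hlr, one_pow]; gcongr
      _ = (Y * l ^ (j + 1)) ^ p := by
          rw [mul_one, ← Real.mul_rpow hl0.le (by positivity)]; congr 1; ring

/-- De Giorgi iteration: the functions `y` and `W` stand for `|{u > m}|^{1/r}` and
`‖(u - m)⁺‖_{L^r}`. -/
theorem exists_level_eq_zero {p q r B K m₀ : ℝ} (hp : 0 < p) (hpq : p ≤ q) (hqr : q < r)
    (hB : 0 < B) (hK : 0 < K) (hm₀ : 1 ≤ m₀) :
    ∃ C : ℝ, 0 < C ∧ ∀ y W : ℝ → ℝ, (∀ m, 0 ≤ y m) → (∀ m, 0 ≤ W m) → Antitone y →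
      (∀ m, m₀ ≤ m → W m ≤ K) → (∀ m h, m₀ ≤ m → m ≤ h → (h - m) * y h ≤ W m) →
      (∀ m, m₀ ≤ m → W m ^ p ≤ B * (m ^ q * y m ^ r + W m ^ q * y m ^ (r - q))) →
      y C = 0 := by
  have hpr : p < r := hpq.trans_lt hqr
  set l : ℝ := (2 : ℝ) ^ (-(p / (r - p))) with hl
  have hl0 : 0 < l := by positivity
  have hl1 : l < 1 := Real.rpow_lt_one_of_one_lt_of_neg one_lt_two
    (neg_lt_zero.2 (div_pos hp (by linarith)))
  -- Two requirements on M, both decaying like M^(-(r-q)): `t1` serves the absorption, `t2` the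
  -- smallness of the starting value.
  have t1 : Filter.Tendsto (fun M : ℝ => B * K ^ (q - p) * (2 * K) ^ (r - q) * M ^ (-(r - q)))
      Filter.atTop (nhds 0) := by
    simpa using (tendsto_rpow_neg_atTop (by linarith : 0 < r - q)).const_mul
      (B * K ^ (q - p) * (2 * K) ^ (r - q))
  have t2 : Filter.Tendsto (fun M : ℝ => 2 * B * 2 ^ (q + p) * (2 * K) ^ (r - p) * M ^ (-(r - q)))
      Filter.atTop (nhds 0) := by
    simpa using (tendsto_rpow_neg_atTop (by linarith : 0 < r - q)).const_mul
      (2 * B * 2 ^ (q + p) * (2 * K) ^ (r - p))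
  obtain ⟨M, h1, h2, hM⟩ := ((t1.eventually_le_const (by norm_num : (0 : ℝ) < 1 / 2)).and
    ((t2.eventually_le_const (by positivity : 0 < l ^ p)).and
      (Filter.eventually_ge_atTop (2 * m₀)))).exists
  have hM0 : 0 < M := by linarith
  refine ⟨2 * M, by linarith, fun y W hy hW hanti hWK hcheb hineq => ?_⟩
  -- Chebyshev from level m₀, with m - m₀ ≥ M/2 because M ≥ 2m₀.
  have hyM : ∀ m, M ≤ m → y m ≤ 2 * K / M := by
    intro m hm
    rw [le_div_iff₀ hM0]
    have := (hcheb m₀ m le_rfl (by linarith)).trans (hWK m₀ le_rfl)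
    nlinarith [hy m]
  -- Writing W^q = W^p W^(q-p) with W ≤ K, the second term is at most W^p / 2.
  have habs : ∀ m, M ≤ m → W m ^ p ≤ 2 * B * m ^ q * y m ^ r := by
    intro m hm
    have hWq : W m ^ q = W m ^ p * W m ^ (q - p) := by
      rcases (hW m).eq_or_lt with h | h
      · rw [← h, Real.zero_rpow hp.ne', Real.zero_rpow (by linarith), zero_mul]
      · rw [← Real.rpow_add h]; congr 1; ring
    have hsmall : B * (W m ^ (q - p) * y m ^ (r - q)) ≤ 1 / 2 := by
      refine le_trans ?_ h1
      calc B * (W m ^ (q - p) * y m ^ (r - q)) ≤ B * (K ^ (q - p) * (2 * K / M) ^ (r - q)) := by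
            gcongr
            · exact Real.rpow_nonneg (hy m) _
            · exact hW m
            · exact hWK m (by linarith)
            · exact hy m
            · exact hyM m hm
        _ = _ := by
          rw [Real.div_rpow (by positivity) hM0.le, Real.rpow_neg hM0.le]; ring
    have := hineq m (by linarith)
    have hWp : 0 ≤ W m ^ p := Real.rpow_nonneg (hW m) _
    rw [hWq] at this
    nlinarith [mul_le_mul_of_nonneg_left hsmall hWp]
  -- Levels from M towards 2M, with gaps M 2^(-j-1).
  let k : ℕ → ℝ := fun j => M * (2 - (1 / 2) ^ j)
  have hpow : ∀ j : ℕ, (0 : ℝ) < (1 / 2) ^ j ∧ ((1 / 2 : ℝ)) ^ j ≤ 1 := fun j =>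
    ⟨by positivity, pow_le_one₀ (by norm_num) (by norm_num)⟩
  have hkM : ∀ j, M ≤ k j := fun j => by nlinarith [hpow j]
  have hk2M : ∀ j, k j ≤ 2 * M := fun j => by nlinarith [hpow j]
  have hgeom := le_geometric_of_rpow_le (p := p) (r := r) (b := 2) (Y := 2 * K / M)
    (c := 2 * B * 2 ^ (q + p) * M ^ (q - p)) hp hpr (by positivity) one_lt_two (by positivity)
    (by
      refine le_trans (le_of_eq ?_) h2
      rw [Real.div_rpow (by positivity) hM0.le, show -(r - q) = (q - p) - (r - p) by ring,
        Real.rpow_sub hM0 (q - p)]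
      ring)
    (y := fun j => y (k j)) (fun j => hy _) (hyM _ (hkM 0))
    (by
      intro j
      have hd : k (j + 1) - k j = M * ((1 / 2) ^ j / 2) := by simp only [k]; ring
      have hd0 : 0 < k (j + 1) - k j := by rw [hd]; have := (hpow j).1; positivity
      have e1 : (k (j + 1) - k j) ^ p * y (k (j + 1)) ^ p ≤ 2 * B * (2 * M) ^ q * y (k j) ^ r := by
        rw [← Real.mul_rpow hd0.le (hy _)]
        calc _ ≤ W (k j) ^ p := by
              gcongr
              · exact mul_nonneg hd0.le (hy _)
              · exact hcheb _ _ (by linarith [hkM j]) (by linarith)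
          _ ≤ _ := habs _ (hkM j)
          _ ≤ _ := by
            gcongr
            · exact Real.rpow_nonneg (hy _) _
            · linarith [hkM j]
            · linarith
            · exact hk2M j
      have e2 : (k (j + 1) - k j) ^ p = M ^ p * (2 ^ p)⁻¹ * ((2 ^ p) ^ j)⁻¹ := by
        rw [hd, Real.mul_rpow hM0.le (by positivity), Real.div_rpow (by positivity) (by norm_num),
          ← Real.rpow_pow_comm (by norm_num), Real.div_rpow (by norm_num) (by norm_num),
          Real.one_rpow, div_pow, one_pow]
        ring
      rw [e2] at e1
      have hMp : 0 < M ^ p := by positivity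
      have h2p : (0 : ℝ) < 2 ^ p := by positivity
      have e3 : y (k (j + 1)) ^ p ≤
          (2 ^ p * (2 ^ p) ^ j / M ^ p) * (2 * B * (2 * M) ^ q * y (k j) ^ r) := by
        calc y (k (j + 1)) ^ p = (2 ^ p * (2 ^ p) ^ j / M ^ p) *
              (M ^ p * (2 ^ p)⁻¹ * ((2 ^ p) ^ j)⁻¹ * y (k (j + 1)) ^ p) := by
              field_simp
          _ ≤ _ := by gcongr
      refine e3.trans (le_of_eq ?_)
      rw [Real.mul_rpow (by norm_num) hM0.le, Real.rpow_sub hM0, Real.rpow_add (by norm_num)]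
      field_simp)
  have hlim : Filter.Tendsto (fun j : ℕ => 2 * K / M * l ^ j) Filter.atTop (nhds 0) := by
    simpa using (tendsto_pow_atTop_nhds_zero_of_lt_one hl0.le hl1).const_mul (2 * K / M)
  exact le_antisymm (ge_of_tendsto' hlim fun j => (hanti (hk2M j)).trans (hgeom j)) (hy _)

/-- For p < N take s = p and r = p^*. For p = N take r = q + 2 and let s be the exponent whose
Sobolev conjugate is r; then s < N, and s ≥ 1 because N ≥ 2 and r ≥ 2. -/
theorem exists_sobolev_exponents {N : ℕ} {p q : ℝ} (hp : 1 < p) (hpN : p ≤ N) (hpq : p ≤ q)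
    (hq : (q : EReal) < sobolevExponent N p) :
    ∃ s r : NNReal, 1 ≤ s ∧ (s : ℝ) ≤ p ∧ (r : ℝ)⁻¹ = (s : ℝ)⁻¹ - (N : ℝ)⁻¹ ∧ q < r := by
  have hN : (0 : ℝ) < N := by linarith
  rcases hpN.lt_or_eq with h | h
  · rw [sobolevExponent, if_pos h, EReal.coe_lt_coe_iff] at hq
    have hd : 0 < (N : ℝ) - p := by linarith
    refine ⟨⟨p, by linarith⟩, ⟨N * p / (N - p), by positivity⟩, ?_, le_rfl, ?_, hq⟩
    · exact hp.le
    · change (N * p / (N - p) : ℝ)⁻¹ = p⁻¹ - (N : ℝ)⁻¹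
      have : p ≠ 0 := by linarith
      field_simp
  · have hN2 : (2 : ℝ) ≤ N := by
      have : 1 < N := by exact_mod_cast h ▸ hp
      exact_mod_cast this
    have hr : 0 < q + 2 := by linarith
    refine ⟨⟨N * (q + 2) / (N + (q + 2)), by positivity⟩, ⟨q + 2, hr.le⟩, ?_, ?_, ?_, ?_⟩
    · change (1 : ℝ) ≤ N * (q + 2) / (N + (q + 2))
      rw [le_div_iff₀ (by positivity)]
      nlinarith
    · change N * (q + 2) / (N + (q + 2)) ≤ p
      rw [h, div_le_iff₀ (by positivity)]
      nlinarith
    · change (q + 2)⁻¹ = (N * (q + 2) / (N + (q + 2)))⁻¹ - (N : ℝ)⁻¹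
      field_simp
      ring
    · change q < q + 2
      linarith

/-! ### Estimates on superlevel sets -/

section Superlevel

variable {N : ℕ} {Ω : Set (EuclideanSpace ℝ (Fin N))} {u : EuclideanSpace ℝ (Fin N) → ℝ} {m : ℝ}

theorem superlevel_eq_inter : superlevel Ω u m = {x | m < u x} ∩ Ω := by
  ext x; simp [superlevel, and_comm]

theorem superlevel_anti {h : ℝ} (hmh : m ≤ h) : superlevel Ω u h ⊆ superlevel Ω u m :=
  fun _ hx => ⟨hx.1, hmh.trans_lt hx.2⟩

theorem aestronglyMeasurable_truncation (hu : AEStronglyMeasurable u (volume.restrict Ω)) :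
    AEStronglyMeasurable (fun x => max (u x - m) 0) (volume.restrict Ω) :=
  (by fun_prop : Continuous fun t : ℝ => max (t - m) 0).comp_aestronglyMeasurable hu

/-- On the superlevel set u = (u - m)⁺ + m; convexity of t^q splits the sum and Hölder passes from
L^q to L^r. -/
theorem lintegral_superlevel_rpow_le (hΩ : MeasurableSet Ω)
    (hu : AEStronglyMeasurable u (volume.restrict Ω)) (hm : 0 ≤ m) {q : ℝ} (hq : 1 ≤ q)
    {r : NNReal} (hqr : q ≤ r) :
    ∫⁻ x in superlevel Ω u m, ‖u x‖ₑ ^ q ≤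
      2 ^ (q - 1) * (eLpNorm (fun x => max (u x - m) 0) r (volume.restrict Ω) ^ q *
        volume (superlevel Ω u m) ^ (1 - q / r) +
          ENNReal.ofReal (m ^ q) * volume (superlevel Ω u m)) := by
  have hq0 : 0 < q := by linarith
  have hr0 : (0 : ℝ) < r := by linarith
  set w : EuclideanSpace ℝ (Fin N) → ℝ := fun x => max (u x - m) 0 with hw
  set A := superlevel Ω u m with hA
  have hwm : AEStronglyMeasurable w (volume.restrict Ω) := aestronglyMeasurable_truncation hu
  have hrestr : volume.restrict A = (volume.restrict Ω).restrict {x | m < u x} := by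
    rw [Measure.restrict_restrict' hΩ, hA, superlevel_eq_inter]
  have hnull : NullMeasurableSet {x | m < u x} (volume.restrict Ω) :=
    nullMeasurableSet_lt aemeasurable_const hu.aemeasurable
  have hAΩ : volume.restrict A ≤ volume.restrict Ω :=
    Measure.restrict_mono (fun x hx => hx.1) le_rfl
  have hpt : ∀ᵐ x ∂(volume.restrict A), ‖u x‖ₑ ^ q ≤
      2 ^ (q - 1) * (‖w x‖ₑ ^ q + ENNReal.ofReal (m ^ q)) := by
    rw [hrestr]
    filter_upwards [ae_restrict_mem₀ hnull] with x hx
    have hx' : m < u x := hx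
    have h1 : ‖u x‖ₑ = ‖w x‖ₑ + ENNReal.ofReal m := by
      rw [hw, Real.enorm_of_nonneg (by linarith), Real.enorm_of_nonneg (le_max_right _ _),
        max_eq_left (by linarith), ← ENNReal.ofReal_add (by linarith) hm]
      congr 1; ring
    rw [h1, ← ENNReal.ofReal_rpow_of_nonneg hm hq0.le]
    exact ENNReal.rpow_add_le_mul_rpow_add_rpow _ _ hq
  refine (lintegral_mono_ae hpt).trans ?_
  rw [lintegral_const_mul' _ _ (ENNReal.rpow_ne_top_of_nonneg (by linarith) (by simp)),
    lintegral_add_right _ measurable_const, setLIntegral_const]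
  gcongr
  have hq1 : ENNReal.ofReal q ≠ 0 := by simpa using hq0
  have hqr' : ENNReal.ofReal q ≤ r := by
    rw [← ENNReal.ofReal_coe_nnreal]; exact ENNReal.ofReal_le_ofReal hqr
  have hH := eLpNorm_le_eLpNorm_mul_rpow_measure_univ hqr' (hwm.mono_measure hAΩ)
  have hI : ∫⁻ x in A, ‖w x‖ₑ ^ q = eLpNorm w (ENNReal.ofReal q) (volume.restrict A) ^ q := by
    rw [eLpNorm_eq_lintegral_rpow_enorm_toReal hq1 ENNReal.ofReal_ne_top,
      ENNReal.toReal_ofReal hq0.le, ← ENNReal.rpow_mul, one_div_mul_cancel hq0.ne',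
      ENNReal.rpow_one]
  rw [hI]
  refine (ENNReal.rpow_le_rpow hH hq0.le).trans ?_
  rw [ENNReal.mul_rpow_of_nonneg _ _ hq0.le, ← ENNReal.rpow_mul, ENNReal.toReal_ofReal hq0.le,
    ENNReal.coe_toReal, Measure.restrict_apply_univ,
    show (1 / q - 1 / (r : ℝ)) * q = 1 - q / r by field_simp]
  gcongr

/-- Chebyshev: (u - m)⁺ ≥ h - m where u > h. -/
theorem ofReal_mul_volume_superlevel_rpow_le (hΩ : MeasurableSet Ω)
    (hu : AEStronglyMeasurable u (volume.restrict Ω)) {h : ℝ} {r : NNReal} (hr : 0 < r) :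
    ENNReal.ofReal (h - m) * volume (superlevel Ω u h) ^ (1 / (r : ℝ)) ≤
      eLpNorm (fun x => max (u x - m) 0) r (volume.restrict Ω) := by
  have hr' : (0 : ℝ) < r := hr
  rw [← ENNReal.rpow_le_rpow_iff hr', ENNReal.mul_rpow_of_nonneg _ _ hr'.le, ← ENNReal.rpow_mul,
    one_div_mul_cancel hr'.ne', ENNReal.rpow_one]
  refine le_trans ?_ (mul_meas_ge_le_pow_eLpNorm' (volume.restrict Ω)
    (by exact_mod_cast hr.ne') ENNReal.coe_ne_top (aestronglyMeasurable_truncation (m := m) hu)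
    (ENNReal.ofReal (h - m)))
  rw [ENNReal.coe_toReal, superlevel_eq_inter, ← Measure.restrict_apply' hΩ]
  refine mul_le_mul_right (measure_mono fun x hx => ?_) _
  have hx' : h < u x := hx
  simp only [Set.mem_ofPred_eq]
  rw [Real.enorm_of_nonneg (le_max_right _ _)]
  exact ENNReal.ofReal_le_ofReal ((by linarith : h - m ≤ u x - m).trans (le_max_left _ _))

end Superlevel

/-! ### Uniform bound from above -/

/-- Hölder raises the gradient exponent from s to p; a bound `v` on the level set, rather than |Ω|,
keeps the constant independent of the domain. -/
theorem MemW01p.eLpNorm_truncation_le_of_volume_le {N : ℕ} {Ω : Set (EuclideanSpace ℝ (Fin N))}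
    {p : ℝ} {u : EuclideanSpace ℝ (Fin N) → ℝ}
    {g : EuclideanSpace ℝ (Fin N) → EuclideanSpace ℝ (Fin N)} (h : MemW01p Ω p u g)
    (hΩ : MeasurableSet Ω) (hΩ' : volume Ω ≠ ⊤) (hN : 0 < N) {s r : NNReal}
    (hs : 1 ≤ s) (hsp : s ≤ p) (hsr : (r : ℝ)⁻¹ = s⁻¹ - (N : ℝ)⁻¹) {m : ℝ} (hm : 0 ≤ m)
    {v : ℝ≥0∞} (hv : volume (superlevel Ω u m) ≤ v) :
    eLpNorm (fun x => max (u x - m) 0) r (volume.restrict Ω) ≤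
      SNormLESNormFDerivOfEqConst ℝ (volume : Measure (EuclideanSpace ℝ (Fin N))) s *
        v ^ (1 / (s : ℝ) - 1 / p) *
          eLpNorm g (ENNReal.ofReal p) (volume.restrict (superlevel Ω u m)) := by
  have hs0 : (0 : ℝ) < s := zero_lt_one.trans_le hs
  have hsp' : (s : ℝ≥0∞) ≤ ENNReal.ofReal p := by
    rw [← ENNReal.ofReal_coe_nnreal]; exact ENNReal.ofReal_le_ofReal hsp
  refine (h.eLpNorm_truncation_le hΩ hΩ' hN hs hsp hsr hm).trans ?_
  rw [mul_assoc]
  gcongr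
  refine (eLpNorm_le_eLpNorm_mul_rpow_measure_univ hsp' (h.memW1p.memLp_grad.1.mono_measure
    (Measure.restrict_mono (fun x hx => hx.1) le_rfl))).trans ?_
  rw [mul_comm, ENNReal.coe_toReal, ENNReal.toReal_ofReal (by linarith),
    Measure.restrict_apply_univ]
  gcongr
  exact sub_nonneg.2 (one_div_le_one_div_of_le hs0 hsp)

/-- Uniform upper bound for functions in `W_0^{1,p}(Ω)` which satisfy an energy estimate on their
superlevel sets. -/
theorem exists_essSup_le_of_energy_superlevel {N : ℕ} {m₀ p q a a₀ : ℝ} (hp : 1 < p)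
    (hpN : p ≤ N) (hpq : p ≤ q) (hq : (q : EReal) < sobolevExponent N p) (hm₀ : 1 ≤ m₀) :
    ∃ C : ℝ, 0 < C ∧
      ∀ (Ω : Set (EuclideanSpace ℝ (Fin N))), IsOpen Ω → Bornology.IsBounded Ω →
      ∀ (u : EuclideanSpace ℝ (Fin N) → ℝ)
        (g : EuclideanSpace ℝ (Fin N) → EuclideanSpace ℝ (Fin N)), MemW01p Ω p u g →
        (∀ m : ℝ, m₀ ≤ m →
            ∫⁻ x in superlevel Ω u m, ‖g x‖ₑ ^ p ≤
              ENNReal.ofReal a * (ENNReal.ofReal (m ^ q) * volume (superlevel Ω u m) +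
                ∫⁻ x in superlevel Ω u m, ‖u x‖ₑ ^ q)) →
          max (volume (superlevel Ω u m₀)) (sobolevNorm Ω p u g) ≤ ENNReal.ofReal a₀ →
          essSup (fun x => (u x : EReal)) (volume.restrict Ω) ≤ (C : EReal) := by
  have hp0 : 0 < p := by linarith
  have hq0 : 0 < q := by linarith
  have hN : 0 < N := by
    have : (0 : ℝ) < N := by linarith
    exact_mod_cast this
  obtain ⟨s, r, hs, hsp, hsr, hqr⟩ := exists_sobolev_exponents hp hpN hpq hq
  have hs0 : (0 : ℝ) < s := zero_lt_one.trans_le hs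
  have hr0 : (0 : ℝ) < r := by linarith
  set D : ℝ≥0∞ := SNormLESNormFDerivOfEqConst ℝ
    (volume : Measure (EuclideanSpace ℝ (Fin N))) s * ENNReal.ofReal a₀ ^ (1 / (s : ℝ) - 1 / p)
  have hD : D ≠ ⊤ := ENNReal.mul_ne_top ENNReal.coe_ne_top (ENNReal.rpow_ne_top_of_nonneg
    (sub_nonneg.2 (one_div_le_one_div_of_le hs0 hsp)) ENNReal.ofReal_ne_top)
  -- The factor 2^q dominates 1 + 2^(q-1), the total coefficient of m^q |Ω_m^+|. The added 1, here
  -- and in `K`, ensures positivity.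
  set B : ℝ≥0∞ := D ^ p * ENNReal.ofReal a * 2 ^ q + 1
  have hB : B ≠ ⊤ := by
    have := ENNReal.rpow_ne_top_of_nonneg hp0.le hD
    have h2 : (2 : ℝ≥0∞) ^ q ≠ ⊤ := ENNReal.rpow_ne_top_of_nonneg hq0.le (by simp)
    exact ENNReal.add_ne_top.2 ⟨ENNReal.mul_ne_top (ENNReal.mul_ne_top this
      ENNReal.ofReal_ne_top) h2, ENNReal.one_ne_top⟩
  set K : ℝ≥0∞ := D * ENNReal.ofReal a₀ + 1
  have hK : K ≠ ⊤ := ENNReal.add_ne_top.2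
    ⟨ENNReal.mul_ne_top hD ENNReal.ofReal_ne_top, ENNReal.one_ne_top⟩
  obtain ⟨C, hC, hCy⟩ := exists_level_eq_zero (p := p) (q := q) (r := r) (B := B.toReal)
    (K := K.toReal) (m₀ := m₀) hp0 hpq hqr (ENNReal.toReal_pos (by simp [B]) hB)
    (ENNReal.toReal_pos (by simp [K]) hK) hm₀
  refine ⟨C, hC, fun Ω hΩo hΩb u g h henergy hmax => ?_⟩
  have hΩ := hΩo.measurableSet
  have hΩ' : volume Ω ≠ ⊤ := hΩb.measure_lt_top.ne
  have hu := h.memW1p.memLp.1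
  have hvol : ∀ m, volume (superlevel Ω u m) ≠ ⊤ := fun m =>
    ne_top_of_le_ne_top hΩ' (measure_mono fun x hx => hx.1)
  set V : ℝ → ℝ≥0∞ := fun m => volume (superlevel Ω u m)
  set W : ℝ → ℝ≥0∞ := fun m => eLpNorm (fun x => max (u x - m) 0) r (volume.restrict Ω)
  have hWD : ∀ m, m₀ ≤ m → W m ≤ D * eLpNorm g (ENNReal.ofReal p)
      (volume.restrict (superlevel Ω u m)) := fun m hm =>
    h.eLpNorm_truncation_le_of_volume_le hΩ hΩ' hN hs hsp hsr (by linarith)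
      ((measure_mono (superlevel_anti hm)).trans ((le_max_left _ _).trans hmax))
  have hWK : ∀ m, m₀ ≤ m → W m ≤ K := by
    intro m hm
    refine (hWD m hm).trans (le_trans ?_ le_self_add)
    gcongr
    refine (eLpNorm_mono_measure _ (Measure.restrict_mono (fun x hx => hx.1) le_rfl)).trans ?_
    exact (eLpNorm_le_sobolevNorm Ω hp0 u g).2.trans ((le_max_right _ _).trans hmax)
  have hWtop : ∀ m, m₀ ≤ m → W m ≠ ⊤ := fun m hm => ne_top_of_le_ne_top hK (hWK m hm)
  have hmain : ∀ m, m₀ ≤ m → W m ^ p ≤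
      B * (ENNReal.ofReal (m ^ q) * V m + W m ^ q * V m ^ (1 - q / r)) := by
    intro m hm
    have hI : eLpNorm g (ENNReal.ofReal p) (volume.restrict (superlevel Ω u m)) ^ p =
        ∫⁻ x in superlevel Ω u m, ‖g x‖ₑ ^ p := by
      rw [eLpNorm_eq_lintegral_rpow_enorm_toReal (by simpa using hp0) ENNReal.ofReal_ne_top,
        ENNReal.toReal_ofReal hp0.le, ← ENNReal.rpow_mul, one_div_mul_cancel hp0.ne',
        ENNReal.rpow_one]
    have h2 : (2 : ℝ≥0∞) ^ q = 2 ^ (q - 1) + 2 ^ (q - 1) := by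
      rw [← two_mul]
      nth_rewrite 2 [← ENNReal.rpow_one 2]
      rw [← ENNReal.rpow_add _ _ (by simp) (by simp)]
      congr 1; ring
    have h1 : (1 : ℝ≥0∞) ≤ 2 ^ (q - 1) := ENNReal.one_le_rpow (by norm_num) (by linarith)
    calc W m ^ p ≤ D ^ p * ∫⁻ x in superlevel Ω u m, ‖g x‖ₑ ^ p := by
          rw [← hI, ← ENNReal.mul_rpow_of_nonneg _ _ hp0.le]
          exact ENNReal.rpow_le_rpow (hWD m hm) hp0.le
      _ ≤ D ^ p * (ENNReal.ofReal a * (ENNReal.ofReal (m ^ q) * V m +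
            2 ^ (q - 1) * (W m ^ q * V m ^ (1 - q / r) + ENNReal.ofReal (m ^ q) * V m))) := by
          gcongr
          refine (henergy m hm).trans ?_
          gcongr
          exact lintegral_superlevel_rpow_le hΩ hu (by linarith) (by linarith) hqr.le
      _ ≤ D ^ p * (ENNReal.ofReal a * (2 ^ q *
            (ENNReal.ofReal (m ^ q) * V m + W m ^ q * V m ^ (1 - q / r)))) := by
          gcongr
          rw [h2]
          calc _ ≤ 2 ^ (q - 1) * (ENNReal.ofReal (m ^ q) * V m) + 2 ^ (q - 1) *
                (W m ^ q * V m ^ (1 - q / r) + ENNReal.ofReal (m ^ q) * V m) +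
                2 ^ (q - 1) * (W m ^ q * V m ^ (1 - q / r)) :=
                le_trans (add_le_add (le_mul_of_one_le_left zero_le h1) le_rfl) le_self_add
            _ = _ := by ring
      _ = (D ^ p * ENNReal.ofReal a * 2 ^ q) *
            (ENNReal.ofReal (m ^ q) * V m + W m ^ q * V m ^ (1 - q / r)) := by ring
      _ ≤ _ := by gcongr; exact le_self_add
  -- Passing to reals: finiteness of `W m` is known here only for m ≥ m₀; below that, a default
  -- value 0 of `toReal` would be harmless, as only nonnegativity is asked.
  have hzero := hCy (fun m => (V m).toReal ^ (1 / (r : ℝ))) (fun m => (W m).toReal)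
    (fun m => by positivity) (fun m => by positivity)
    (fun m h hmh => by
      have := ENNReal.toReal_mono (hvol m) (measure_mono (superlevel_anti (Ω := Ω) (u := u) hmh))
      dsimp only
      gcongr)
    (fun m hm => ENNReal.toReal_mono hK (hWK m hm))
    (fun m h hm hmh => by
      have := ENNReal.toReal_mono (hWtop m hm)
        (ofReal_mul_volume_superlevel_rpow_le (m := m) (h := h) hΩ hu (r := r) hr0)
      rwa [ENNReal.toReal_mul, ENNReal.toReal_ofReal (by linarith), ← ENNReal.toReal_rpow] at this)
    (fun m hm => by
      have hV1 : ENNReal.ofReal (m ^ q) * V m ≠ ⊤ :=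
        ENNReal.mul_ne_top ENNReal.ofReal_ne_top (hvol m)
      have he : 0 ≤ 1 - q / r := sub_nonneg.2 ((div_le_one hr0).2 hqr.le)
      have hV2 : W m ^ q * V m ^ (1 - q / r) ≠ ⊤ :=
        ENNReal.mul_ne_top (ENNReal.rpow_ne_top_of_nonneg hq0.le (hWtop m hm))
          (ENNReal.rpow_ne_top_of_nonneg he (hvol m))
      have := ENNReal.toReal_mono (ENNReal.mul_ne_top hB (ENNReal.add_ne_top.2 ⟨hV1, hV2⟩))
        (hmain m hm)
      rw [ENNReal.toReal_mul, ENNReal.toReal_add hV1 hV2, ENNReal.toReal_mul, ENNReal.toReal_mul,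
        ← ENNReal.toReal_rpow, ← ENNReal.toReal_rpow, ← ENNReal.toReal_rpow,
        ENNReal.toReal_ofReal (Real.rpow_nonneg (by linarith) _)] at this
      rw [← Real.rpow_mul ENNReal.toReal_nonneg, ← Real.rpow_mul ENNReal.toReal_nonneg,
        one_div_mul_cancel hr0.ne', Real.rpow_one,
        show 1 / (r : ℝ) * (r - q) = 1 - q / r by field_simp]
      exact this)
  have hVC : V C = 0 := by
    rw [Real.rpow_eq_zero ENNReal.toReal_nonneg (by positivity)] at hzero
    exact ((ENNReal.toReal_eq_zero_iff _).1 hzero).resolve_right (hvol C)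
  refine essSup_le_of_ae_le _ ?_
  have : (volume.restrict Ω) {x | C < u x} = 0 := by
    rwa [Measure.restrict_apply' hΩ, ← superlevel_eq_inter]
  filter_upwards [measure_eq_zero_iff_ae_notMem.1 this] with x hx
  exact EReal.coe_le_coe_iff.2 (not_lt.1 hx)

/-! ### Reflection u ↦ -u -/

theorem gradient_neg' {E : Type*} [NormedAddCommGroup E] [InnerProductSpace ℝ E]
    [CompleteSpace E] (f : E → ℝ) (x : E) : gradient (fun y => -f y) x = -gradient f x := by
  simp [gradient, fderiv_fun_neg]

section Neg

variable {N : ℕ} {Ω : Set (EuclideanSpace ℝ (Fin N))} {p : ℝ}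
  {u : EuclideanSpace ℝ (Fin N) → ℝ} {g : EuclideanSpace ℝ (Fin N) → EuclideanSpace ℝ (Fin N)}

theorem sublevel_eq_superlevel_neg (m : ℝ) :
    sublevel Ω u m = superlevel Ω (fun x => -u x) m := by
  ext x; simp [sublevel, superlevel, lt_neg]

theorem sobolevNorm_neg : sobolevNorm Ω p (fun x => -u x) (fun x => -g x) = sobolevNorm Ω p u g := by
  simp [sobolevNorm]

theorem IsTestFunction.neg {φ : EuclideanSpace ℝ (Fin N) → ℝ} (h : IsTestFunction Ω φ) :
    IsTestFunction Ω (fun x => -φ x) where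
  smooth := h.smooth.neg
  compact_support := h.compact_support.neg
  support_subset := by
    have : Function.support (fun x => -φ x) = Function.support φ := by ext; simp
    rw [tsupport, this]; exact h.support_subset

theorem MemW01p.neg (h : MemW01p Ω p u g) : MemW01p Ω p (fun x => -u x) (fun x => -g x) where
  memW1p :=
    { memLp := h.memW1p.memLp.neg
      memLp_grad := h.memW1p.memLp_grad.neg
      isWeakGradient :=
        { locallyIntegrable := h.memW1p.isWeakGradient.locallyIntegrable.neg
          locallyIntegrable_grad := h.memW1p.isWeakGradient.locallyIntegrable_grad.neg
          integral_eq := fun φ hφ => by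
            simp only [neg_smul, smul_neg, integral_neg]
            rw [h.memW1p.isWeakGradient.integral_eq φ hφ] } }
  exists_approx := fun ε hε => by
    obtain ⟨φ, hφ, hlt⟩ := h.exists_approx ε hε
    refine ⟨fun x => -φ x, hφ.neg, ?_⟩
    rw [← sobolevNorm_neg] at hlt
    convert! hlt using 2
    · ext x; ring
    · ext1 x; rw [gradient_neg']; abel

end Neg

theorem lemma5p6 (N m₀ : ℕ) (p q a a₀ : ℝ) (hp : 1 < p) (hpN : p ≤ N) (hpq : p ≤ q)
    (hq : (q : EReal) < sobolevExponent N p) (ha : 0 < a) (hm₀ : 1 ≤ m₀) (ha₀ : 0 < a₀) :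
    ∃ C : ℝ, 0 < C ∧
      ∀ (Ω : Set (EuclideanSpace ℝ (Fin N))), IsOpen Ω → Bornology.IsBounded Ω →
      ∀ (u : EuclideanSpace ℝ (Fin N) → ℝ)
        (g : EuclideanSpace ℝ (Fin N) → EuclideanSpace ℝ (Fin N)), MemW01p Ω p u g →
        ((∀ m : ℝ, (m₀ : ℝ) ≤ m →
            ∫⁻ x in superlevel Ω u m, ‖g x‖ₑ ^ p ≤
              ENNReal.ofReal a * (ENNReal.ofReal (m ^ q) * volume (superlevel Ω u m) +
                ∫⁻ x in superlevel Ω u m, ‖u x‖ₑ ^ q)) →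
          max (volume (superlevel Ω u m₀)) (sobolevNorm Ω p u g) ≤ ENNReal.ofReal a₀ →
          essSup (fun x => (u x : EReal)) (volume.restrict Ω) ≤ (C : EReal)) ∧
        ((∀ m : ℝ, (m₀ : ℝ) ≤ m →
            ∫⁻ x in sublevel Ω u m, ‖g x‖ₑ ^ p ≤
              ENNReal.ofReal a * (ENNReal.ofReal (m ^ q) * volume (sublevel Ω u m) +
                ∫⁻ x in sublevel Ω u m, ‖u x‖ₑ ^ q)) →
          max (volume (sublevel Ω u m₀)) (sobolevNorm Ω p u g) ≤ ENNReal.ofReal a₀ →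
          essSup (fun x => ((-u x : ℝ) : EReal)) (volume.restrict Ω) ≤ (C : EReal)) := by
  obtain ⟨C, hC, hbound⟩ := exists_essSup_le_of_energy_superlevel (N := N) (m₀ := (m₀ : ℝ)) hp hpN
    hpq hq (a := a) (a₀ := a₀)
    (by exact_mod_cast hm₀)
  refine ⟨C, hC, fun Ω hΩ hΩb u g h => ⟨hbound Ω hΩ hΩb u g h, fun henergy hmax => ?_⟩⟩
  -- The same C serves both parts, as it was fixed before the function.
  refine hbound Ω hΩ hΩb _ _ h.neg (fun m hm => ?_) ?_
  · simpa only [enorm_neg, ← sublevel_eq_superlevel_neg] using henergy m hm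
  · rwa [sobolevNorm_neg, ← sublevel_eq_superlevel_neg]
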